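/- Let $n\ge 1$ be an integer and let $K\subset\mathbb R^n$ be a convex body (a compact convex set with nonempty interior). Let $C(K)$ be the space of continuous functions $f:K\to\mathbb R$ with the norm $\|f\|_{C(K)}=\max_{x\in K}|f(x)|$, and let $\Pi_1(\mathbb R^n)$ be the space of polynomials in $n$ variables of degree at most $1$. For a nondegenerate $n$-dimensional simplex $S$ with vertices $x^{(1)},\dots,x^{(n+1)}\in K$, let $P_S:C(K)\to\Pi_1(\mathbb R^n)$ be the interpolation projector with nodes $x^{(j)}$, i.e. the linear operator determined by $P_Sf(x^{(j)})=f(x^{(j)})$ for $1\le j\le n+1$, and let $\|P_S\|_K$ be its norm as an operator from $C(K)$ to $C(K)$. Let $\theta_n(K)$ be the minimum of $\|P_S\|_K$ over all nondegenerate simplices $S$ with vertices in $K$. Let $B_n=\{x\in\mathbb R^n:\|x\|\le 1\}$ be the closed unit Euclidean ball. Theorem. For every $n\ge 1$ the minimum $\theta_n(B_n)$ is attained. There exists an absolute constant $c>0$ such that, for every $n\ge1$, $$\theta_n(B_n)>c\sqrt n .$$ This inequality holds for every $n\ge1$ with the constant $$c=\frac{\sqrt[3]{\pi}}{\sqrt{12e}\cdot\sqrt[6]{3}}=0.2135\ldots,$$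 where the decimal expansion means $0.2135<c<0.2136$. -/

import Mathlib

/-- `P : C(K) → C(K)` is the linear interpolation projector on `K ⊆ ℝⁿ` whose nodes are the vertices
of the nondegenerate simplex `S`: every `P f` is (the restriction to `K` of) a polynomial in `n`
variables of degree at most `1`, i.e. an affine function on `ℝⁿ`, and it agrees with `f` at
the nodes, all of which lie in `K`. The space `C(K)` carries the uniform norm. -/
structure IsInterpolationProjector {n : ℕ} (K : Set (EuclideanSpace ℝ (Fin n))) [CompactSpace K]
    (S : Affine.Simplex ℝ (EuclideanSpace ℝ (Fin n)) n) (P : C(K, ℝ) →L[ℝ] C(K, ℝ)) : Prop where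
  nodes_mem : ∀ j, S.points j ∈ K
  exists_affine : ∀ f : C(K, ℝ), ∃ p : EuclideanSpace ℝ (Fin n) →ᵃ[ℝ] ℝ, ∀ x : K, P f x = p x
  interpolates : ∀ (f : C(K, ℝ)) (j : Fin (n + 1)),
    P f ⟨S.points j, nodes_mem j⟩ = f ⟨S.points j, nodes_mem j⟩

/-- The operator norms on `C(K)` of all linear interpolation projectors with nodes in `K`. -/
def interpolationNorms {n : ℕ} (K : Set (EuclideanSpace ℝ (Fin n))) [CompactSpace K] : Set ℝ :=
  {r | ∃ (S : Affine.Simplex ℝ (EuclideanSpace ℝ (Fin n)) n) (P : C(K, ℝ) →L[ℝ] C(K, ℝ)),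
    IsInterpolationProjector K S P ∧ r = ‖P‖}

/-- `θ_n(K)`: the minimal operator norm of a linear interpolation projector with nodes in `K`,
as the infimum of these norms; that it is attained is expressed by `IsLeast`. -/
noncomputable def theta {n : ℕ} (K : Set (EuclideanSpace ℝ (Fin n))) [CompactSpace K] : ℝ :=
  sInf (interpolationNorms K)

/-- The closed unit Euclidean ball `B_n`. -/
def unitBall (n : ℕ) : Set (EuclideanSpace ℝ (Fin n)) := Metric.closedBall 0 1

instance unitBall.instCompactSpace (n : ℕ) : CompactSpace (unitBall n) :=
  isCompact_iff_compactSpace.mp (isCompact_closedBall 0 1)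

/-- The explicit constant `∛π / (√(12e) · ⁶√3) = 0.2135…`. -/
noncomputable def ballConstant : ℝ :=
  Real.pi ^ (1 / 3 : ℝ) / (Real.sqrt (12 * Real.exp 1) * (3 : ℝ) ^ (1 / 6 : ℝ))

/-! The barycentric coordinates of the nodes are `⟪w j, y⟫ + c j`, and `‖P‖` bounds the sum of their
absolute values on the ball. Symmetry under `y ↦ -y` removes the `c j`, so every signed sum of the
`w j` has norm at most `‖P‖`. Suitable signs then give `∑ ‖w j‖² ≤ ‖P‖²`. The trace of `y = ∑ ⟪w j,
y⟫ x j` gives `n = ∑ ⟪w j, x j⟫ ≤ ∑ ‖w j‖`, and Cauchy–Schwarz yields `n² ≤ (n + 1) ‖P‖²`. Hence any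
constant with square below `1 / 2` works, in particular `ballConstant`. Attainment follows from
compactness of the dual systems with bounded `r`. -/

/-- Nodes `x j` in the closed unit ball, with dual affine functionals `y ↦ ⟪w j, y⟫ + c j` whose
Lebesgue function is bounded by `r` on the ball. -/
def IsDualSystem {n : ℕ} (x w : Fin (n + 1) → EuclideanSpace ℝ (Fin n)) (c : Fin (n + 1) → ℝ)
    (r : ℝ) : Prop :=
  (∀ j, ‖x j‖ ≤ 1) ∧ (∀ i j, inner ℝ (w j) (x i) + c j = if i = j then 1 else 0) ∧
    ∀ y : EuclideanSpace ℝ (Fin n), ‖y‖ ≤ 1 → ∑ j, |inner ℝ (w j) y + c j| ≤ r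

/-! ### Choice of signs in an inner product space -/

section Signs

variable {V : Type*} [NormedAddCommGroup V] [InnerProductSpace ℝ V]

/-- By the parallelogram law the left side is the average of the two right sides. -/
theorem sum_sq_norm_le_sq_norm_add_or_sub (u v : V) :
    ‖u‖ ^ 2 + ‖v‖ ^ 2 ≤ ‖u + v‖ ^ 2 ∨ ‖u‖ ^ 2 + ‖v‖ ^ 2 ≤ ‖u - v‖ ^ 2 := by
  by_contra! h
  have := parallelogram_law_with_norm ℝ u v
  nlinarith [h.1, h.2]

/-- Some choice of signs makes the squared norm of the signed sum at least the sum of the squared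
norms. -/
theorem exists_signs_sum_sq_norm_le {ι : Type*} (s : Finset ι) (w : ι → V) :
    ∃ ε : ι → ℝ, (∀ i, |ε i| = 1) ∧ ∑ i ∈ s, ‖w i‖ ^ 2 ≤ ‖∑ i ∈ s, ε i • w i‖ ^ 2 := by
  classical
  induction s using Finset.induction_on with
  | empty => exact ⟨fun _ => 1, by simp, by simp⟩
  | insert a s ha ih =>
    obtain ⟨ε, hε, h⟩ := ih
    have key : ∀ t : ℝ, ∑ i ∈ insert a s, Function.update ε a t i • w i
        = t • w a + ∑ i ∈ s, ε i • w i := fun t => by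
      rw [Finset.sum_insert ha, Function.update_self]
      congr 1
      refine Finset.sum_congr rfl fun i hi => ?_
      rw [Function.update_of_ne (ne_of_mem_of_not_mem hi ha)]
    have sgn : ∀ t : ℝ, |t| = 1 → ∀ i, |Function.update ε a t i| = 1 := fun t ht i => by
      rcases eq_or_ne i a with rfl | hi
      · simpa using ht
      · simpa [Function.update_of_ne hi] using hε i
    rcases sum_sq_norm_le_sq_norm_add_or_sub (∑ i ∈ s, ε i • w i) (w a) with h' | h'
    · refine ⟨Function.update ε a 1, sgn 1 (by simp), ?_⟩
      rw [key, Finset.sum_insert ha, one_smul, add_comm (w a)]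
      linarith
    · refine ⟨Function.update ε a (-1), sgn (-1) (by simp), ?_⟩
      rw [key, Finset.sum_insert ha, neg_one_smul, neg_add_eq_sub]
      linarith

end Signs

/-! ### Projector norm and barycentric coordinates -/

section Projector

variable {n : ℕ}

/-- The vertices of a simplex of full dimension, as an affine basis. -/
noncomputable def Affine.Simplex.toAffineBasis
    (S : Affine.Simplex ℝ (EuclideanSpace ℝ (Fin n)) n) :
    AffineBasis (Fin (n + 1)) ℝ (EuclideanSpace ℝ (Fin n)) :=
  ⟨S.points, S.independent, by
    rw [S.independent.affineSpan_eq_top_iff_card_eq_finrank_add_one]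
    simp⟩

theorem Affine.Simplex.toAffineBasis_apply
    (S : Affine.Simplex ℝ (EuclideanSpace ℝ (Fin n)) n) (j : Fin (n + 1)) :
    S.toAffineBasis j = S.points j := rfl

theorem AffineMap.eq_sum_coord_mul {ι V : Type*} [Fintype ι] [AddCommGroup V] [Module ℝ V]
    (b : AffineBasis ι ℝ V) (p : V →ᵃ[ℝ] ℝ) (y : V) :
    p y = ∑ j, b.coord j y * p (b j) := by
  conv_lhs => rw [← b.affineCombination_coord_eq_self y]
  rw [Finset.map_affineCombination _ _ _ (b.sum_coord_apply_eq_one y),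
    Finset.affineCombination_eq_linear_combination _ _ _ (b.sum_coord_apply_eq_one y)]
  simp

variable {K : Set (EuclideanSpace ℝ (Fin n))} [CompactSpace K]
  {S : Affine.Simplex ℝ (EuclideanSpace ℝ (Fin n)) n} {P : C(K, ℝ) →L[ℝ] C(K, ℝ)}

theorem IsInterpolationProjector.apply_eq (h : IsInterpolationProjector K S P) (f : C(K, ℝ))
    (y : K) :
    P f y = ∑ j, S.toAffineBasis.coord j y * f ⟨S.points j, h.nodes_mem j⟩ := by
  obtain ⟨p, hp⟩ := h.exists_affine f
  rw [hp, AffineMap.eq_sum_coord_mul S.toAffineBasis p]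
  refine Finset.sum_congr rfl fun j _ => ?_
  rw [← h.interpolates f j, hp]
  rfl

theorem IsInterpolationProjector.sum_abs_coord_le (h : IsInterpolationProjector K S P) (y : K) :
    ∑ j, |S.toAffineBasis.coord j y| ≤ ‖P‖ := by
  set b := S.toAffineBasis with hb
  let s : Fin (n + 1) → ℝ := fun j => SignType.sign (b.coord j y)
  have hs : ∀ j, |s j| ≤ 1 := fun j => by
    rcases lt_trichotomy (b.coord j y) 0 with h0 | h0 | h0 <;> simp [s, h0]
  have hc : ∀ j, Continuous (b.coord j) := fun j =>
    AffineMap.continuous_of_finiteDimensional _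
  -- The affine function with the signs at `y` as nodal values, clamped to `[-1, 1]`; clamping keeps
  -- these values and makes the norm at most one.
  let f : C(K, ℝ) := ⟨fun z => max (-1) (min 1 (∑ j, s j * b.coord j z)), by
    have := fun j => (hc j).comp (continuous_subtype_val (p := (· ∈ K)))
    simp only [Function.comp_def] at this
    fun_prop⟩
  have hf : ‖f‖ ≤ 1 := by
    refine (ContinuousMap.norm_le _ zero_le_one).2 fun z => ?_
    rw [Real.norm_eq_abs, abs_le]
    exact ⟨le_max_left _ _, max_le (by norm_num) (min_le_left _ _)⟩
  have hfj : ∀ j, f ⟨S.points j, h.nodes_mem j⟩ = s j := fun j => by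
    have : ∑ i, s i * b.coord i (S.points j) = s j := by
      simp_rw [← Affine.Simplex.toAffineBasis_apply, ← hb, AffineBasis.coord_apply]
      simp
    have h1 := abs_le.1 (hs j)
    change max (-1) (min 1 (∑ i, s i * b.coord i (S.points j))) = s j
    rw [this, min_eq_right h1.2, max_eq_right h1.1]
  calc ∑ j, |b.coord j y| = P f y := by
        rw [h.apply_eq]
        refine Finset.sum_congr rfl fun j _ => ?_
        rw [hfj, ← hb]
        exact (self_mul_sign (b.coord j y)).symm
    _ ≤ ‖P f y‖ := le_abs_self _
    _ ≤ ‖P f‖ := (P f).norm_coe_le_norm y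
    _ ≤ ‖P‖ * ‖f‖ := P.le_opNorm f
    _ ≤ ‖P‖ := mul_le_of_le_one_right P.opNorm_nonneg hf

end Projector

/-! ### Dual systems on the ball -/

section Ball

variable {n : ℕ}

theorem exists_inner_add_eq_affineMap (p : EuclideanSpace ℝ (Fin n) →ᵃ[ℝ] ℝ) :
    ∃ (w : EuclideanSpace ℝ (Fin n)) (c : ℝ), ∀ y, p y = inner ℝ w y + c := by
  refine ⟨(InnerProductSpace.toDual ℝ _).symm p.linear.toContinuousLinearMap, p 0, fun y => ?_⟩
  rw [InnerProductSpace.toDual_symm_apply]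
  exact congrFun p.decomp y

theorem IsInterpolationProjector.exists_isDualSystem
    {S : Affine.Simplex ℝ (EuclideanSpace ℝ (Fin n)) n}
    {P : C(unitBall n, ℝ) →L[ℝ] C(unitBall n, ℝ)}
    (h : IsInterpolationProjector (unitBall n) S P) :
    ∃ w c, IsDualSystem S.points w c ‖P‖ ∧
      ∀ y, y = ∑ j, (inner ℝ (w j) y : ℝ) • S.points j := by
  choose w c hwc using fun j => exists_inner_add_eq_affineMap (S.toAffineBasis.coord j)
  refine ⟨w, c, ⟨fun j => by simpa [unitBall] using h.nodes_mem j, fun i j => ?_, fun y hy => ?_⟩,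
    fun y => ?_⟩
  · rw [← hwc, ← Affine.Simplex.toAffineBasis_apply, AffineBasis.coord_apply]
    simp only [eq_comm]
  · simpa only [hwc] using h.sum_abs_coord_le ⟨y, by simpa [unitBall] using hy⟩
  -- At the origin the expansion reads `∑ c j • x j = 0`, which removes the constants.
  · have h1 := S.toAffineBasis.linear_combination_coord_eq_self y
    have h0 := S.toAffineBasis.linear_combination_coord_eq_self 0
    simp only [hwc, inner_zero_right, zero_add, add_smul, Finset.sum_add_distrib] at h1 h0
    rw [h0, add_zero] at h1
    exact h1.symm

namespace IsDualSystem

variable {x w : Fin (n + 1) → EuclideanSpace ℝ (Fin n)} {c : Fin (n + 1) → ℝ} {r : ℝ}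

theorem nonneg (h : IsDualSystem x w c r) : 0 ≤ r :=
  (Finset.sum_nonneg fun _ _ => abs_nonneg _).trans (h.2.2 0 (by simp))

theorem affineIndependent (h : IsDualSystem x w c r) : AffineIndependent ℝ x := by
  rw [affineIndependent_iff]
  intro s t ht0 ht i hi
  have h1 : ∑ e ∈ s, t e * (inner ℝ (w i) (x e) + c i) = 0 := by
    have h2 := congrArg (inner ℝ (w i)) ht
    simp only [inner_sum, inner_smul_right, inner_zero_right] at h2
    simp_rw [mul_add]
    rw [Finset.sum_add_distrib, h2, ← Finset.sum_mul, ht0]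
    simp
  simpa [h.2.1, hi] using h1

theorem exists_isInterpolationProjector (h : IsDualSystem x w c r) :
    ∃ S P, IsInterpolationProjector (unitBall n) S P ∧ ‖P‖ ≤ r := by
  have hx : ∀ j, x j ∈ unitBall n := fun j => by simpa [unitBall] using h.1 j
  let l : Fin (n + 1) → C(unitBall n, ℝ) := fun j => ⟨fun y => inner ℝ (w j) y.1 + c j, by fun_prop⟩
  let P : C(unitBall n, ℝ) →L[ℝ] C(unitBall n, ℝ) :=
    ∑ j, (ContinuousMap.evalCLM ℝ (⟨x j, hx j⟩ : unitBall n)).smulRight (l j)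
  have hP : ∀ f y, P f y = ∑ j, f ⟨x j, hx j⟩ * (inner ℝ (w j) y.1 + c j) := fun f y => by
    simp [P, l, ContinuousMap.evalCLM, ContinuousMap.sum_apply]
  refine ⟨⟨x, h.affineIndependent⟩, P, ⟨hx, fun f => ?_, fun f j => ?_⟩, ?_⟩
  · refine ⟨(∑ j, f ⟨x j, hx j⟩ • (innerₛₗ ℝ (w j))).toAffineMap +
      AffineMap.const ℝ _ (∑ j, f ⟨x j, hx j⟩ * c j), fun y => ?_⟩
    rw [hP]
    simp [mul_add, Finset.sum_add_distrib]
  · rw [hP]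
    simp [h.2.1]
  · refine P.opNorm_le_bound h.nonneg fun f => ?_
    refine (ContinuousMap.norm_le _ (mul_nonneg h.nonneg (norm_nonneg _))).2 fun y => ?_
    rw [hP, Real.norm_eq_abs]
    calc |∑ j, f ⟨x j, hx j⟩ * (inner ℝ (w j) y.1 + c j)|
        ≤ ∑ j, |f ⟨x j, hx j⟩ * (inner ℝ (w j) y.1 + c j)| := Finset.abs_sum_le_sum_abs _ _
      _ ≤ ∑ j, |inner ℝ (w j) y.1 + c j| * ‖f‖ := by
        refine Finset.sum_le_sum fun j _ => ?_
        rw [abs_mul, mul_comm]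
        exact mul_le_mul_of_nonneg_left (f.norm_coe_le_norm _) (abs_nonneg _)
      _ = (∑ j, |inner ℝ (w j) y.1 + c j|) * ‖f‖ := by rw [Finset.sum_mul]
      _ ≤ r * ‖f‖ := by
        refine mul_le_mul_of_nonneg_right (h.2.2 y.1 ?_) (norm_nonneg _)
        simpa [unitBall] using y.2

/-- Average the bounds at `y` and `-y`: the constants cancel by the triangle inequality. -/
theorem sum_abs_inner_le (h : IsDualSystem x w c r) {y : EuclideanSpace ℝ (Fin n)}
    (hy : ‖y‖ ≤ 1) : ∑ j, |inner ℝ (w j) y| ≤ r := by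
  have h1 := h.2.2 y hy
  have h2 := h.2.2 (-y) (by simpa using hy)
  have h3 : ∑ j, 2 * |inner ℝ (w j) y| ≤
      ∑ j, (|inner ℝ (w j) y + c j| + |inner ℝ (w j) (-y) + c j|) := by
    refine Finset.sum_le_sum fun j _ => ?_
    rw [inner_neg_right, ← abs_two (α := ℝ), ← abs_mul]
    convert! abs_sub (inner ℝ (w j) y + c j) (-inner ℝ (w j) y + c j) using 2
    ring
  rw [← Finset.mul_sum, Finset.sum_add_distrib] at h3
  linarith

/-- A signed sum of the gradients of the dual functionals has norm at most `r`. -/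
theorem norm_sum_smul_le (h : IsDualSystem x w c r) {ε : Fin (n + 1) → ℝ} (hε : ∀ i, |ε i| ≤ 1) :
    ‖∑ i, ε i • w i‖ ≤ r := by
  set v := ∑ i, ε i • w i with hv
  rcases eq_or_ne v 0 with h0 | h0
  · simpa [h0] using h.nonneg
  have hn : ‖v‖ ≠ 0 := norm_ne_zero_iff.2 h0
  have hy : ‖‖v‖⁻¹ • v‖ ≤ 1 := by rw [norm_smul, norm_inv, norm_norm, inv_mul_cancel₀ hn]
  calc ‖v‖ = inner ℝ v (‖v‖⁻¹ • v) := by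
        rw [inner_smul_right, real_inner_self_eq_norm_sq]
        field_simp
    _ = ∑ i, ε i * inner ℝ (w i) (‖v‖⁻¹ • v) := by
        conv_lhs => rw [hv, sum_inner]
        simp only [real_inner_smul_left, ← hv]
    _ ≤ ∑ i, |inner ℝ (w i) (‖v‖⁻¹ • v)| := by
        refine Finset.sum_le_sum fun i _ => (le_abs_self _).trans ?_
        rw [abs_mul]
        exact mul_le_of_le_one_left (abs_nonneg _) (hε i)
    _ ≤ r := h.sum_abs_inner_le hy

theorem norm_le (h : IsDualSystem x w c r) (j : Fin (n + 1)) : ‖w j‖ ≤ r := by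
  simpa [Pi.single_apply, ite_smul] using
    h.norm_sum_smul_le (ε := Pi.single j 1) fun i => by
      rw [Pi.single_apply]; split_ifs <;> simp

theorem abs_const_le (h : IsDualSystem x w c r) (j : Fin (n + 1)) : |c j| ≤ r := by
  have := h.2.2 0 (by simp)
  simp only [inner_zero_right, zero_add] at this
  exact (Finset.single_le_sum (f := fun j => |c j|) (fun _ _ => abs_nonneg _)
    (Finset.mem_univ j)).trans this

theorem sq_le_of_reproducing (h : IsDualSystem x w c r)
    (hr : ∀ y, y = ∑ j, (inner ℝ (w j) y : ℝ) • x j) : (n : ℝ) ^ 2 ≤ (n + 1) * r ^ 2 := by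
  -- Trace of the identity, read off coordinatewise from `hr`.
  have trace : (n : ℝ) = ∑ j, inner ℝ (w j) (x j) := by
    have h1 : ∀ i : Fin n, (1 : ℝ) = ∑ j, w j i * x j i := fun i => by
      have := congrArg (fun v : EuclideanSpace ℝ (Fin n) => v i) (hr (EuclideanSpace.single i 1))
      simpa [EuclideanSpace.inner_single_right] using this
    calc (n : ℝ) = ∑ _i : Fin n, (1 : ℝ) := by simp
      _ = ∑ i : Fin n, ∑ j, w j i * x j i := Finset.sum_congr rfl fun i _ => h1 i
      _ = ∑ j, inner ℝ (w j) (x j) := by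
        rw [Finset.sum_comm]
        simp [PiLp.inner_apply, mul_comm]
  have le_sum : (n : ℝ) ≤ ∑ j, ‖w j‖ := by
    rw [trace]
    refine Finset.sum_le_sum fun j _ => (real_inner_le_norm _ _).trans ?_
    exact mul_le_of_le_one_right (norm_nonneg _) (h.1 j)
  obtain ⟨ε, hε, hs⟩ := exists_signs_sum_sq_norm_le Finset.univ w
  have hle := h.norm_sum_smul_le fun i => (hε i).le
  have cs := sq_sum_le_card_mul_sum_sq (s := Finset.univ) (f := fun j => ‖w j‖)
  simp only [Finset.card_univ, Fintype.card_fin, Nat.cast_add, Nat.cast_one] at cs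
  calc (n : ℝ) ^ 2 ≤ (∑ j, ‖w j‖) ^ 2 := by gcongr
    _ ≤ (n + 1) * ∑ j, ‖w j‖ ^ 2 := cs
    _ ≤ (n + 1) * r ^ 2 := by gcongr; exact hs.trans (by gcongr)

end IsDualSystem

/-! ### Existence of a minimal projector -/

theorem exists_isDualSystem (n : ℕ) :
    ∃ (x w : Fin (n + 1) → EuclideanSpace ℝ (Fin n)) (c : Fin (n + 1) → ℝ) (r : ℝ),
      IsDualSystem x w c r := by
  let e : Fin n → EuclideanSpace ℝ (Fin n) := fun i => EuclideanSpace.single i 1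
  -- Barycentric coordinates of the simplex with vertices `0` and the `e i`.
  let w : Fin (n + 1) → EuclideanSpace ℝ (Fin n) := Fin.cons (-∑ i, e i) e
  let c : Fin (n + 1) → ℝ := Fin.cons 1 fun _ => 0
  refine ⟨Fin.cons 0 e, w, c, ∑ j, (‖w j‖ + |c j|), fun j => ?_, fun i j => ?_, fun y hy => ?_⟩
  · refine Fin.cases ?_ (fun i => ?_) j <;> simp [e]
  · refine Fin.cases ?_ (fun i => ?_) i <;> refine Fin.cases ?_ (fun j => ?_) j
    · simp [w, c]
    · simp [w, c, (Fin.succ_ne_zero j).symm]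
    · simp [w, c, e, sum_inner, EuclideanSpace.inner_single_left]
    · simp [w, c, e, EuclideanSpace.inner_single_left, eq_comm]
  · refine Finset.sum_le_sum fun j _ => (abs_add_le _ _).trans ?_
    gcongr
    exact (abs_real_inner_le_norm _ _).trans (mul_le_of_le_one_right (norm_nonneg _) hy)

theorem isCompact_isDualSystem (n : ℕ) (M : ℝ) :
    IsCompact {q : (Fin (n + 1) → EuclideanSpace ℝ (Fin n)) ×
      (Fin (n + 1) → EuclideanSpace ℝ (Fin n)) × (Fin (n + 1) → ℝ) × ℝ |
      IsDualSystem q.1 q.2.1 q.2.2.1 q.2.2.2 ∧ q.2.2.2 ≤ M} := by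
  refine Metric.isCompact_of_isClosed_isBounded ?_ ?_
  · simp only [IsDualSystem, Set.ofPred_and, Set.ofPred_forall]
    refine IsClosed.inter (IsClosed.inter ?_ (IsClosed.inter ?_ ?_)) ?_
    · exact isClosed_iInter fun j => isClosed_le (by fun_prop) (by fun_prop)
    · exact isClosed_iInter fun i => isClosed_iInter fun j => isClosed_eq (by fun_prop) (by fun_prop)
    · exact isClosed_iInter fun y => isClosed_iInter fun _ => isClosed_le (by fun_prop) (by fun_prop)
    · exact isClosed_le (by fun_prop) (by fun_prop)
  · refine Metric.isBounded_closedBall (x := 0) (r := max 1 M) |>.subset ?_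
    rintro ⟨x, w, c, r⟩ ⟨h, hr⟩
    have h1 : (0 : ℝ) ≤ max 1 M := zero_le_one.trans (le_max_left _ _)
    have h2 : r ≤ max 1 M := le_trans hr (le_max_right _ _)
    rw [mem_closedBall_zero_iff]
    simp only [Prod.norm_def, sup_le_iff, pi_norm_le_iff_of_nonneg h1]
    refine ⟨fun j => (h.1 j).trans (le_max_left _ _), fun j => (h.norm_le j).trans h2,
      fun j => (h.abs_const_le j).trans h2, ?_⟩
    rw [Real.norm_eq_abs, abs_of_nonneg h.nonneg]
    exact h2

theorem exists_isLeast_interpolationNorms (n : ℕ) :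
    ∃ r, IsLeast (interpolationNorms (unitBall n)) r := by
  obtain ⟨x₀, w₀, c₀, M, h₀⟩ := exists_isDualSystem n
  obtain ⟨⟨x, w, c, r⟩, ⟨h, hM⟩, hmin⟩ := (isCompact_isDualSystem n M).exists_isMinOn
    ⟨(x₀, w₀, c₀, M), h₀, le_rfl⟩ (f := fun q => q.2.2.2) (by fun_prop)
  have lower : ∀ t ∈ interpolationNorms (unitBall n), r ≤ t := by
    rintro t ⟨S, P, hP, rfl⟩
    obtain ⟨w', c', h', -⟩ := hP.exists_isDualSystem
    -- Norms above `M` fall outside the compact set but cannot beat `r ≤ M`.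
    rcases le_total ‖P‖ M with hle | hle
    · exact hmin (a := (S.points, w', c', ‖P‖)) ⟨h', hle⟩
    · exact hM.trans hle
  obtain ⟨S, P, hP, hle⟩ := h.exists_isInterpolationProjector
  have hmem : ‖P‖ ∈ interpolationNorms (unitBall n) := ⟨S, P, hP, rfl⟩
  exact ⟨‖P‖, hmem, fun t ht => hle.trans (lower t ht)⟩

/-- The minimal norm is attained. -/
theorem isLeast_theta_unitBall (n : ℕ) :
    IsLeast (interpolationNorms (unitBall n)) (theta (unitBall n)) := by
  obtain ⟨r, hr⟩ := exists_isLeast_interpolationNorms n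
  rwa [theta, hr.csInf_eq]

theorem sq_le_mul_sq_theta_unitBall (n : ℕ) :
    (n : ℝ) ^ 2 ≤ (n + 1) * theta (unitBall n) ^ 2 := by
  obtain ⟨S, P, hP, h⟩ := (isLeast_theta_unitBall n).1
  obtain ⟨w, c, hd, hr⟩ := hP.exists_isDualSystem
  rw [h]
  exact hd.sq_le_of_reproducing hr

theorem theta_unitBall_nonneg (n : ℕ) : 0 ≤ theta (unitBall n) := by
  obtain ⟨S, P, -, h⟩ := (isLeast_theta_unitBall n).1
  rw [h]
  exact P.opNorm_nonneg

theorem mul_sqrt_lt_theta_unitBall {n : ℕ} (hn : 1 ≤ n) {c : ℝ} (hc : c ^ 2 < 1 / 2) :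
    c * Real.sqrt n < theta (unitBall n) := by
  have h1 : (1 : ℝ) ≤ n := by exact_mod_cast hn
  refine lt_of_pow_lt_pow_left₀ 2 (theta_unitBall_nonneg n) ?_
  rw [mul_pow, Real.sq_sqrt (by positivity)]
  have h2 := sq_le_mul_sq_theta_unitBall n
  -- Uses `n + 1 ≤ 2 * n`.
  have h3 : (n : ℝ) / 2 ≤ theta (unitBall n) ^ 2 := by
    nlinarith [sq_nonneg (theta (unitBall n))]
  nlinarith

end Ball

/-! ### Numerical bounds, via the sixth power that clears all roots -/

theorem ballConstant_pos : 0 < ballConstant := by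
  unfold ballConstant
  positivity

theorem ballConstant_pow_six : ballConstant ^ 6 = Real.pi ^ 2 / (5184 * Real.exp 1 ^ 3) := by
  have h1 : (Real.pi ^ (1 / 3 : ℝ)) ^ 6 = Real.pi ^ 2 := by
    rw [← Real.rpow_natCast, ← Real.rpow_mul Real.pi_pos.le, ← Real.rpow_natCast]
    norm_num
  have h2 : Real.sqrt (12 * Real.exp 1) ^ 6 = 1728 * Real.exp 1 ^ 3 := by
    rw [show 6 = 2 * 3 from rfl, pow_mul, Real.sq_sqrt (by positivity)]
    ring
  have h3 : ((3 : ℝ) ^ (1 / 6 : ℝ)) ^ 6 = 3 := by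
    rw [← Real.rpow_natCast, ← Real.rpow_mul (by norm_num)]
    norm_num
  rw [ballConstant, div_pow, mul_pow, h1, h2, h3]
  congr 1
  ring

theorem lt_ballConstant : (0.2135 : ℝ) < ballConstant := by
  refine lt_of_pow_lt_pow_left₀ 6 ballConstant_pos.le ?_
  rw [ballConstant_pow_six, lt_div_iff₀ (by positivity)]
  calc (0.2135 : ℝ) ^ 6 * (5184 * Real.exp 1 ^ 3) ≤ 0.2135 ^ 6 * (5184 * 2.7182818286 ^ 3) := by
        gcongr; exact Real.exp_one_lt_d9.le
    _ < 3.1415 ^ 2 := by norm_num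
    _ ≤ Real.pi ^ 2 := by gcongr; exact Real.pi_gt_d4.le

theorem ballConstant_lt : ballConstant < 0.2136 := by
  refine lt_of_pow_lt_pow_left₀ 6 (by norm_num) ?_
  rw [ballConstant_pow_six, div_lt_iff₀ (by positivity)]
  calc Real.pi ^ 2 ≤ 3.1416 ^ 2 := by gcongr; exact Real.pi_lt_d4.le
    _ < 0.2136 ^ 6 * (5184 * 2.7182818283 ^ 3) := by norm_num
    _ ≤ 0.2136 ^ 6 * (5184 * Real.exp 1 ^ 3) := by gcongr; exact Real.exp_one_gt_d9.le

theorem mainTheorem5 :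
    (∀ n : ℕ, 1 ≤ n → IsLeast (interpolationNorms (unitBall n)) (theta (unitBall n))) ∧
    (∃ c : ℝ, 0 < c ∧ ∀ n : ℕ, 1 ≤ n → c * Real.sqrt n < theta (unitBall n)) ∧
    (∀ n : ℕ, 1 ≤ n → ballConstant * Real.sqrt n < theta (unitBall n)) ∧
    (0.2135 : ℝ) < ballConstant ∧ ballConstant < 0.2136 := by
  have key : ∀ n : ℕ, 1 ≤ n → ballConstant * Real.sqrt n < theta (unitBall n) := fun n hn =>
    mul_sqrt_lt_theta_unitBall hn (by nlinarith [lt_ballConstant, ballConstant_lt])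
  exact ⟨fun n _ => isLeast_theta_unitBall n, ⟨ballConstant, ballConstant_pos, key⟩, key,
    lt_ballConstant, ballConstant_lt⟩
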